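/- Let $V$ be a finite set with $n$ elements, equipped with a fixed linear order, and let $X$ be a simplicial complex on $V$, that is, a family of subsets of $V$ that contains $\emptyset$ and is closed under taking subsets (a singleton $\{v\}$ need not belong to $X$). Let $X(k)$ be the set of $k$-simplices (elements of $X$ with $k+1$ elements, $k\ge -1$), and let $\dim X$ be the largest $k$ with $X(k)\neq\emptyset$. A missing face of $X$ is a subset $\sigma\subseteq V$ with $\sigma\notin X$ all of whose proper subsets lie in $X$; let $d=h(X)$ be the maximal dimension $|\sigma|-1$ of a missing face, with $h(X)=0$ if there is none. Let $\omega\colon V\to\mathbb{R}_{>0}$, and put $\omega(\emptyset)=1$ and $\omega(\sigma)=\prod_{v\in\sigma}\omega(v)$ for $\sigma\in X$. Let $C^k(X,\mathbb{R})$ be the space of real $k$-cochains (real functions on $X(k)$, simplices being oriented by the order of $V$) with the inner product for which the elementary cochains $e_\sigma$ are orthogonal and $\langle e_\sigma,e_\sigma\rangle=\omega(\sigma)$. Let $d_k\colon C^k(X,\mathbb{R})\to C^{k+1}(X,\mathbb{R})$ be the simplicial coboundary map of the augmented complex and $d_k^{\omega*}$ its adjoint, and let $L_k^\omega(X)=d_k^{\omega*}d_k+d_{k-1}d_{k-1}^{\omega*}$.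 Suppose that, for some $k$ with $-1\le k\le\dim X$, the smallest eigenvalue of $L_k^\omega(X)$ equals $$(d+1)\min_{\sigma\in X(k)}\sum_{v\in\sigma}\omega(v)-d\sum_{v\in V}\omega(v).$$ Then $n-k-1\ge 0$, $(d+1)(k+1)-dn\ge 0$, and: (i) $\dim X=k$ and $X\cong\left(\Delta_d^{(d-1)}\right)^{*(n-k-1)}*\Delta_{(d+1)(k+1)-dn-1}$; (ii) for every such isomorphism, $\omega$ is constant on the part of $V$ that corresponds to the vertex set of each of the $n-k-1$ copies of $\Delta_d^{(d-1)}$. Here $\Delta_m$ is the complex of all subsets of a set of $m+1$ vertices (so $\Delta_{-1}=\{\emptyset\}$), $\Delta_d^{(d-1)}$ is the subcomplex of $\Delta_d$ of all simplices of dimension at most $d-1$ on the same $d+1$ vertices, $*$ denotes the join of complexes on disjoint vertex sets (whose simplices are all unions of one simplex from each factor), and an isomorphism is a bijection of the underlying vertex sets (including points that are not simplices) under which a set is a simplex if and only if its image is. -/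

import Mathlib

noncomputable section

namespace PreAbstractSimplicialComplex

variable {V W : Type*}

/-- The simplices of `X`, the empty simplex included: `PreAbstractSimplicialComplex` stores only
the nonempty ones. Not every point of `V` has to be a simplex. -/
def IsSimplex (X : PreAbstractSimplicialComplex V) (s : Finset V) : Prop :=
  s = ∅ ∨ s ∈ X

theorem IsSimplex.mono {X : PreAbstractSimplicialComplex V} {s t : Finset V}
    (hs : X.IsSimplex s) (hts : t ⊆ s) : X.IsSimplex t := by
  rcases t.eq_empty_or_nonempty with rfl | ht
  · exact Or.inl rfl
  · rcases hs with rfl | hs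
    · exact Or.inl (Finset.subset_empty.mp hts)
    · exact Or.inr ((X.isRelLowerSet_faces hs).2 hts ht)

/-- A missing face: a subset of `V` that is not a simplex while all its proper subsets are. -/
def IsMissingFace (X : PreAbstractSimplicialComplex V) (s : Finset V) : Prop :=
  ¬ X.IsSimplex s ∧ ∀ t, t ⊂ s → X.IsSimplex t

/-- `h(X)`, the maximal dimension of a missing face (`0` if there is none, that is, if `X` is the
complete complex on `V`). A missing face is nonempty, so the subtraction does not truncate. -/
def maxMissingDim [Fintype V] (X : PreAbstractSimplicialComplex V) : ℕ :=
  open scoped Classical in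
  (Finset.univ.filter fun s : Finset V => X.IsMissingFace s).sup fun s => s.card - 1

/-- The dimension of `X`; it is at least `-1`, since the empty simplex has dimension `-1`. -/
def dim [Fintype V] (X : PreAbstractSimplicialComplex V) : ℤ :=
  open scoped Classical in
  (((Finset.univ.filter fun s : Finset V => X.IsSimplex s).sup Finset.card : ℕ) : ℤ) - 1

/-- `X(k)`, the set of `k`-dimensional simplices. -/
abbrev KSimplex (X : PreAbstractSimplicialComplex V) (k : ℤ) : Type _ :=
  {s : Finset V // X.IsSimplex s ∧ (s.card : ℤ) = k + 1}

instance [Finite V] (X : PreAbstractSimplicialComplex V) (k : ℤ) : Fintype (X.KSimplex k) :=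
  Fintype.ofFinite _

/-- Real `k`-cochains. Every simplex is oriented by the order of `V`, and a cochain is recorded by
its values on these oriented simplices. -/
abbrev Cochain (X : PreAbstractSimplicialComplex V) (k : ℤ) : Type _ :=
  X.KSimplex k → ℝ

section Laplacian

variable [LinearOrder V]

/-- The incidence number of `t` in `s`: it is `(-1) ^ j` if `t` arises from `s` by deleting the
vertex that has exactly `j` predecessors in `s`, and `0` if `t` is not a facet of `s`. -/
def incidence (s t : Finset V) : ℝ :=
  ∑ v ∈ s, if s.erase v = t then (-1 : ℝ) ^ (s.filter fun u => u < v).card else 0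

variable [Fintype V]

/-- The coboundary map. It is used for `l = k + 1` only; keeping `l` as a variable
avoids identifying `(k - 1) + 1` with `k` in the type of cochains. -/
def coboundary (X : PreAbstractSimplicialComplex V) (k l : ℤ) : X.Cochain k →ₗ[ℝ] X.Cochain l where
  toFun φ s := ∑ t : X.KSimplex k, incidence s.1 t.1 * φ t
  map_add' φ ψ := by
    funext s
    simp [mul_add, Finset.sum_add_distrib]
  map_smul' c φ := by
    funext s
    simp [Finset.mul_sum, mul_left_comm]

/-- The vertex weight function on simplices: the product of the weights of the vertices. -/
def simplexWeight (ω : V → ℝ) (s : Finset V) : ℝ := ∏ v ∈ s, ω v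

/-- The inner product on cochains for which the elementary cochains are orthogonal and the one
of `s` has square norm `simplexWeight ω s`. -/
def cochainInner (X : PreAbstractSimplicialComplex V) (ω : V → ℝ) (k : ℤ) (φ ψ : X.Cochain k) : ℝ :=
  ∑ s : X.KSimplex k, simplexWeight ω s.1 * φ s * ψ s

/-- The adjoint of `coboundary X k l` for the weighted inner products; see
`cochainInner_coboundary` for the adjoint relation, which determines it. -/
def coboundaryAdjoint (X : PreAbstractSimplicialComplex V) (ω : V → ℝ) (k l : ℤ) :
    X.Cochain l →ₗ[ℝ] X.Cochain k where
  toFun ψ t :=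
    ∑ s : X.KSimplex l, simplexWeight ω s.1 / simplexWeight ω t.1 * incidence s.1 t.1 * ψ s
  map_add' φ ψ := by
    funext s
    simp [mul_add, Finset.sum_add_distrib]
  map_smul' c φ := by
    funext s
    simp [Finset.mul_sum, mul_left_comm]

/-- The weighted Laplacian in degree `k`, the sum of the up-Laplacian and the down-Laplacian. -/
def laplacian (X : PreAbstractSimplicialComplex V) (ω : V → ℝ) (k : ℤ) :
    Module.End ℝ (X.Cochain k) :=
  X.coboundaryAdjoint ω k (k + 1) ∘ₗ X.coboundary k (k + 1) +
    X.coboundary (k - 1) k ∘ₗ X.coboundaryAdjoint ω (k - 1) k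

/-- In consecutive degrees `coboundary` is the usual alternating sum over the facets. -/
theorem coboundary_apply (X : PreAbstractSimplicialComplex V) {k l : ℤ} (hl : l = k + 1)
    (φ : X.Cochain k) (s : X.KSimplex l) :
    X.coboundary k l φ s = ∑ v : s.1, (-1 : ℝ) ^ (s.1.filter fun u => u < v.1).card *
      φ ⟨s.1.erase v.1, s.2.1.mono (Finset.erase_subset _ _), by
        have := s.2.2
        have := Finset.card_erase_add_one v.2
        omega⟩ := by
  change ∑ t : X.KSimplex k, incidence s.1 t.1 * φ t = _
  simp only [incidence]
  simp_rw [← Finset.sum_coe_sort s.1, Finset.sum_mul]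
  rw [Finset.sum_comm]
  refine Finset.sum_congr rfl fun v _ => ?_
  rw [Finset.sum_eq_single (⟨s.1.erase v.1, s.2.1.mono (Finset.erase_subset _ _), by
        have := s.2.2
        have := Finset.card_erase_add_one v.2
        omega⟩ : X.KSimplex k)]
  · simp
  · intro t _ ht
    rw [if_neg, zero_mul]
    intro h
    exact ht (Subtype.ext h.symm)
  · simp

theorem cochainInner_coboundary (X : PreAbstractSimplicialComplex V) {ω : V → ℝ}
    (hω : ∀ v, 0 < ω v) (k l : ℤ) (φ : X.Cochain k) (ψ : X.Cochain l) :
    X.cochainInner ω l (X.coboundary k l φ) ψ =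
      X.cochainInner ω k φ (X.coboundaryAdjoint ω k l ψ) := by
  simp only [cochainInner, coboundary, coboundaryAdjoint, LinearMap.coe_mk, AddHom.coe_mk,
    Finset.mul_sum, Finset.sum_mul]
  rw [Finset.sum_comm]
  refine Finset.sum_congr rfl fun t _ => Finset.sum_congr rfl fun s _ => ?_
  have : simplexWeight ω t.1 ≠ 0 := (Finset.prod_pos fun v _ => hω v).ne'
  field_simp

end Laplacian

/-- The `p`-skeleton: the simplices of dimension at most `p`. -/
def skeleton (X : PreAbstractSimplicialComplex V) (p : ℤ) : PreAbstractSimplicialComplex V where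
  faces := {s | s ∈ X ∧ (s.card : ℤ) ≤ p + 1}
  isRelLowerSet_faces := by
    rintro s ⟨hs, hc⟩
    refine ⟨(X.isRelLowerSet_faces hs).1, fun t hts ht =>
      ⟨(X.isRelLowerSet_faces hs).2 hts ht, ?_⟩⟩
    have := Finset.card_le_card hts
    omega

/-- `Δ_d^{(d-1)}`, the `(d - 1)`-skeleton of the complete complex on `d + 1` vertices. -/
def simplexBoundary (d : ℕ) : PreAbstractSimplicialComplex (Fin (d + 1)) :=
  (⊤ : PreAbstractSimplicialComplex (Fin (d + 1))).skeleton ((d : ℤ) - 1)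

/-- The join of two complexes on the disjoint union of their vertex sets. Its simplices are the
unions of a simplex of `X` and a simplex of `Y`. -/
def join (X : PreAbstractSimplicialComplex V) (Y : PreAbstractSimplicialComplex W) :
    PreAbstractSimplicialComplex (V ⊕ W) where
  faces := {s | s.Nonempty ∧ X.IsSimplex s.toLeft ∧ Y.IsSimplex s.toRight}
  isRelLowerSet_faces := by
    rintro s ⟨hs, hX, hY⟩
    exact ⟨hs, fun t hts ht => ⟨ht, hX.mono (Finset.toLeft_subset_toLeft hts),
      hY.mono (Finset.toRight_subset_toRight hts)⟩⟩

/-- The join of `t` disjoint copies of `X`, the `i`-th one on the vertices `(i, v)`. Its simplices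
are the unions of one simplex from each copy. -/
def joinPower (X : PreAbstractSimplicialComplex V) (t : ℕ) :
    PreAbstractSimplicialComplex (Fin t × V) where
  faces := {s | s.Nonempty ∧
    ∀ i, X.IsSimplex (s.preimage (fun v => (i, v)) (Prod.mk_right_injective i).injOn)}
  isRelLowerSet_faces := by
    rintro s ⟨hs, hX⟩
    refine ⟨hs, fun t hts ht => ⟨ht, fun i => (hX i).mono fun v hv => ?_⟩⟩
    rw [Finset.mem_preimage] at hv ⊢
    exact hts hv

/-- An isomorphism: a bijection of the vertex sets that preserves and reflects simplices. -/
structure Iso (X : PreAbstractSimplicialComplex V) (Y : PreAbstractSimplicialComplex W)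
    extends V ≃ W where
  isSimplex_map_iff (s : Finset V) : Y.IsSimplex (s.map toEquiv.toEmbedding) ↔ X.IsSimplex s

end PreAbstractSimplicialComplex

end

/-! Write `a` for the value of an eigenvector at a simplex `s` where its absolute value is largest.
In row `s` of the Laplacian, an outside vertex `u` that extends `s` contributes only to the
diagonal; any other `u` contributes signed values at the simplices `s - v + u`. Such `v` lie in
every missing face inside `s + u`, so there are at most `d` of them. Gershgorin's argument then
bounds the eigenvalue below by the given number.

Equality (`gershgorin_eq`) makes every estimate sharp: `s` has minimal weight, no vertex extends it,
each outside `u` has exactly `d` exchanges, and the values there are `a` up to a prescribed sign. So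
exchanged simplices are again maximal, and the sign rule makes the exchange sets of different
outside vertices disjoint (`isExchangeFamily_isMaxAt`).

The rest is combinatorial. Each `u` with its exchange set (its circuit) is a missing face with `d +
1` vertices, the circuits are disjoint, and exchanges permute them. Moving `s` towards a given set
by exchanges shows that a set is a simplex iff it contains no circuit (`isSimplex_iff`), which is
the join structure. The weight is constant on circuits because an exchange preserves the minimal
total weight. -/

noncomputable section

namespace PreAbstractSimplicialComplex

variable {V : Type*}

/-! ### Cochains extended by zero -/

section Extend

/-- A cochain as a function on all finite sets, zero on those that are not `k`-simplices. -/
def Cochain.extend {X : PreAbstractSimplicialComplex V} {k : ℤ} (φ : X.Cochain k)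
    (s : Finset V) : ℝ :=
  open scoped Classical in
  if h : X.IsSimplex s ∧ (s.card : ℤ) = k + 1 then φ ⟨s, h⟩ else 0

variable {X : PreAbstractSimplicialComplex V} {k : ℤ}

theorem Cochain.extend_coe (φ : X.Cochain k) (s : X.KSimplex k) :
    Cochain.extend φ s.1 = φ s := by
  simp [Cochain.extend, s.2.1, s.2.2]

theorem Cochain.extend_of_isSimplex (φ : X.Cochain k) {s : Finset V} (h : X.IsSimplex s)
    (hc : (s.card : ℤ) = k + 1) : Cochain.extend φ s = φ ⟨s, h, hc⟩ :=
  Cochain.extend_coe φ ⟨s, h, hc⟩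

theorem Cochain.extend_of_not_isSimplex (φ : X.Cochain k) {s : Finset V} (h : ¬ X.IsSimplex s) :
    Cochain.extend φ s = 0 := by
  simp [Cochain.extend, h]

theorem Cochain.sum_ite_eq_extend [Finite V] [DecidableEq V] (φ : X.Cochain k) (s : Finset V) (f : Finset V → ℝ) :
    (∑ t : X.KSimplex k, if s = t.1 then f t.1 * φ t else 0) = f s * Cochain.extend φ s := by
  by_cases h : X.IsSimplex s ∧ (s.card : ℤ) = k + 1
  · rw [Finset.sum_eq_single (⟨s, h⟩ : X.KSimplex k)]
    · simp [Cochain.extend, h]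
    · intro t _ ht
      exact if_neg fun hs => ht (Subtype.ext hs.symm)
    · simp
  · rw [Finset.sum_eq_zero]
    · simp only [Cochain.extend, dif_neg h, mul_zero]
    · intro t _
      exact if_neg fun hs => h (by rw [hs]; exact t.2)

end Extend

/-! ### Signs and the explicit Laplacian -/

section LaplacianFormula

variable [LinearOrder V]

/-- The sign of the vertex `v` in the oriented simplex `insert v t`. -/
def vertexSign (t : Finset V) (v : V) : ℝ := (-1) ^ (t.filter fun u => u < v).card

theorem vertexSign_mul_self (t : Finset V) (v : V) : vertexSign t v * vertexSign t v = 1 := by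
  rw [vertexSign, ← pow_add, ← two_mul, pow_mul]
  simp

theorem abs_vertexSign (t : Finset V) (v : V) : |vertexSign t v| = 1 := by
  simp [vertexSign, abs_pow]

theorem vertexSign_insert_self (t : Finset V) (v : V) :
    vertexSign (insert v t) v = vertexSign t v := by
  simp [vertexSign, Finset.filter_insert]

theorem vertexSign_insert {t : Finset V} {u v : V} (hu : u ∉ t) :
    vertexSign (insert u t) v = if u < v then -vertexSign t v else vertexSign t v := by
  unfold vertexSign
  rw [Finset.filter_insert]
  split_ifs with h
  · rw [Finset.card_insert_of_notMem (by simp [hu]), pow_succ]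
    ring
  · rfl

/-- This is the sign rule behind `d ∘ d = 0`: the up- and down-Laplacian have opposite entries at an
exchange. -/
theorem vertexSign_exchange {t : Finset V} {u v : V} (hu : u ∉ t) (hv : v ∉ t) (huv : u ≠ v) :
    vertexSign (insert v t) u * vertexSign (insert u t) v = -(vertexSign t v * vertexSign t u) := by
  rw [vertexSign_insert hu, vertexSign_insert hv]
  rcases lt_or_gt_of_ne huv with h | h
  · rw [if_neg h.not_gt, if_pos h]
    ring
  · rw [if_pos h, if_neg h.not_gt]
    ring

variable [Fintype V]

theorem incidence_eq_sum_compl (s t : Finset V) :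
    incidence s t = ∑ v ∈ tᶜ, if insert v t = s then vertexSign t v else 0 := by
  rw [incidence, ← Finset.sum_filter, ← Finset.sum_filter]
  have h : (s.filter fun v => s.erase v = t) = tᶜ.filter fun v => insert v t = s := by
    ext v
    simp only [Finset.mem_filter, Finset.mem_compl]
    constructor
    · rintro ⟨hv, rfl⟩
      exact ⟨Finset.notMem_erase v s, Finset.insert_erase hv⟩
    · rintro ⟨hv, rfl⟩
      exact ⟨Finset.mem_insert_self v t, Finset.erase_insert hv⟩
  rw [h]
  refine Finset.sum_congr rfl fun v hv => ?_
  rw [Finset.mem_filter] at hv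
  rw [← hv.2]
  exact vertexSign_insert_self t v

variable {X : PreAbstractSimplicialComplex V} {k l : ℤ}

theorem coboundary_apply_extend (hl : l = k + 1) (φ : X.Cochain k) (s : X.KSimplex l) :
    X.coboundary k l φ s =
      ∑ v ∈ s.1, vertexSign (s.1.erase v) v * Cochain.extend φ (s.1.erase v) := by
  rw [coboundary_apply X hl, ← Finset.sum_coe_sort s.1]
  refine Finset.sum_congr rfl fun v _ => ?_
  rw [← Cochain.extend_coe φ]
  congr 1
  have h := vertexSign_insert_self (s.1.erase v.1) v.1
  rwa [Finset.insert_erase v.2] at h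

theorem coboundaryAdjoint_apply_extend {ω : V → ℝ} (hω : ∀ v, 0 < ω v) (ψ : X.Cochain l)
    (t : X.KSimplex k) :
    X.coboundaryAdjoint ω k l ψ t =
      ∑ u ∈ t.1ᶜ, ω u * vertexSign t.1 u * Cochain.extend ψ (insert u t.1) := by
  change ∑ s : X.KSimplex l, simplexWeight ω s.1 / simplexWeight ω t.1 * incidence s.1 t.1 * ψ s = _
  simp_rw [incidence_eq_sum_compl, Finset.mul_sum, Finset.sum_mul]
  rw [Finset.sum_comm]
  refine Finset.sum_congr rfl fun u hu => ?_
  have ht : simplexWeight ω t.1 ≠ 0 := (Finset.prod_pos fun v _ => hω v).ne'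
  have hw : simplexWeight ω (insert u t.1) / simplexWeight ω t.1 = ω u := by
    rw [simplexWeight, Finset.prod_insert (Finset.mem_compl.mp hu)]
    exact mul_div_cancel_right₀ _ ht
  rw [← hw, ← Cochain.sum_ite_eq_extend ψ _
    fun s => simplexWeight ω s / simplexWeight ω t.1 * vertexSign t.1 u]
  refine Finset.sum_congr rfl fun s _ => ?_
  split_ifs <;> simp

/-- The down part has an exchange sum for every outside `u`; the up part cancels it exactly when `u`
extends `s` and leaves a diagonal term instead. -/
theorem laplacian_apply {ω : V → ℝ} (hω : ∀ v, 0 < ω v) (φ : X.Cochain k) (s : X.KSimplex k) :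
    open scoped Classical in
    X.laplacian ω k φ s = (∑ v ∈ s.1, ω v) * φ s +
      ∑ u ∈ s.1ᶜ, ω u * (if X.IsSimplex (insert u s.1) then φ s else
        ∑ v ∈ s.1, vertexSign (s.1.erase v) v * vertexSign (s.1.erase v) u *
          Cochain.extend φ (insert u (s.1.erase v))) := by
  classical
  have hup : X.coboundaryAdjoint ω k (k + 1) (X.coboundary k (k + 1) φ) s =
      ∑ u ∈ s.1ᶜ, ω u * (if X.IsSimplex (insert u s.1) then φ s -
        ∑ v ∈ s.1, vertexSign (s.1.erase v) v * vertexSign (s.1.erase v) u *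
          Cochain.extend φ (insert u (s.1.erase v)) else 0) := by
    rw [coboundaryAdjoint_apply_extend hω]
    refine Finset.sum_congr rfl fun u hu => ?_
    rw [Finset.mem_compl] at hu
    split_ifs with h
    · rw [Cochain.extend_of_isSimplex _ h (by
        rw [Finset.card_insert_of_notMem hu]
        push_cast
        rw [s.2.2]), coboundary_apply_extend rfl]
      dsimp only
      rw [Finset.sum_insert hu, Finset.erase_insert hu, Cochain.extend_coe, mul_assoc]
      congr 1
      rw [mul_add, ← mul_assoc, vertexSign_mul_self, one_mul, sub_eq_add_neg, Finset.mul_sum,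
        ← Finset.sum_neg_distrib]
      congr 1
      refine Finset.sum_congr rfl fun v hv => ?_
      have huv : u ≠ v := fun h => hu (h ▸ hv)
      rw [Finset.erase_insert_of_ne huv]
      have := vertexSign_exchange (fun h => hu (Finset.mem_of_mem_erase h))
        (Finset.notMem_erase v s.1) huv
      rw [Finset.insert_erase hv] at this
      rw [← mul_assoc, this]
      ring
    · rw [Cochain.extend_of_not_isSimplex _ h]
      ring
  have hdown : X.coboundary (k - 1) k (X.coboundaryAdjoint ω (k - 1) k φ) s =
      (∑ v ∈ s.1, ω v) * φ s + ∑ u ∈ s.1ᶜ, ω u *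
        ∑ v ∈ s.1, vertexSign (s.1.erase v) v * vertexSign (s.1.erase v) u *
          Cochain.extend φ (insert u (s.1.erase v)) := by
    simp_rw [Finset.mul_sum]
    rw [coboundary_apply_extend (by ring), Finset.sum_mul, Finset.sum_comm,
      ← Finset.sum_add_distrib]
    refine Finset.sum_congr rfl fun v hv => ?_
    rw [Cochain.extend_of_isSimplex _ (s.2.1.mono (Finset.erase_subset v s.1)) (by
      have := Finset.card_erase_add_one hv
      have := s.2.2
      omega), coboundaryAdjoint_apply_extend hω]
    dsimp only
    rw [Finset.compl_erase, Finset.sum_insert (by simpa using hv), Finset.insert_erase hv,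
      mul_add, Cochain.extend_coe, Finset.mul_sum]
    congr 1
    · linear_combination ω v * φ s * vertexSign_mul_self (s.1.erase v) v
    · exact Finset.sum_congr rfl fun u _ => by ring
  change X.coboundaryAdjoint ω k (k + 1) (X.coboundary k (k + 1) φ) s +
    X.coboundary (k - 1) k (X.coboundaryAdjoint ω (k - 1) k φ) s = _
  rw [hup, hdown, add_left_comm, ← Finset.sum_add_distrib]
  congr 1
  refine Finset.sum_congr rfl fun u _ => ?_
  split_ifs <;> ring

end LaplacianFormula

/-! ### Missing faces and exchanges -/

section Extremal

variable {V : Type*} {X : PreAbstractSimplicialComplex V}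

theorem IsSimplex.of_forall_not_isMissingFace {s : Finset V}
    (h : ∀ t, t ⊆ s → ¬ X.IsMissingFace t) : X.IsSimplex s := by
  induction s using Finset.strongInduction with
  | H s ih =>
    by_contra hs
    exact h s subset_rfl ⟨hs, fun t ht => ih t ht fun r hr => h r (hr.trans ht.subset)⟩

theorem exists_isMissingFace_subset {s : Finset V} (h : ¬ X.IsSimplex s) :
    ∃ t, t ⊆ s ∧ X.IsMissingFace t := by
  by_contra! H
  exact h (IsSimplex.of_forall_not_isMissingFace H)

theorem IsMissingFace.card_le [Fintype V] {s : Finset V} (h : X.IsMissingFace s) :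
    s.card ≤ X.maxMissingDim + 1 := by
  classical
  have := Finset.le_sup (f := fun s : Finset V => s.card - 1)
    (Finset.mem_filter.mpr ⟨Finset.mem_univ s, h⟩)
  rw [maxMissingDim]
  exact Nat.le_add_of_sub_le this

variable [DecidableEq V]

/-- The vertices of `s` that can be exchanged for `u`. -/
def exchangeSet (X : PreAbstractSimplicialComplex V) (s : Finset V) (u : V) : Finset V :=
  open scoped Classical in s.filter fun v => X.IsSimplex (insert u (s.erase v))

theorem mem_exchangeSet {s : Finset V} {u v : V} :
    v ∈ X.exchangeSet s u ↔ v ∈ s ∧ X.IsSimplex (insert u (s.erase v)) := by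
  simp [exchangeSet]

/-- If `t` avoided an exchangeable `v`, it would lie in the simplex `s - v + u`; if it avoided `u`,
it would lie in `s`. -/
theorem IsMissingFace.exchangeSet_subset {s t : Finset V} {u : V} (ht : X.IsMissingFace t)
    (hts : t ⊆ insert u s) (hs : X.IsSimplex s) : insert u (X.exchangeSet s u) ⊆ t := by
  intro v hv
  by_contra hvt
  apply ht.1
  rcases Finset.mem_insert.mp hv with rfl | hv
  · exact hs.mono ((Finset.subset_insert_iff_of_notMem hvt).mp hts)
  · refine (mem_exchangeSet.mp hv).2.mono fun w hw => ?_
    have := hts hw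
    have hwv : w ≠ v := fun h => hvt (h ▸ hw)
    simp only [Finset.mem_insert, Finset.mem_erase] at this ⊢
    tauto

theorem card_exchangeSet_le [Fintype V] {s : Finset V} {u : V} (hs : X.IsSimplex s) (hu : u ∉ s)
    (hus : ¬ X.IsSimplex (insert u s)) : (X.exchangeSet s u).card ≤ X.maxMissingDim := by
  obtain ⟨t, hts, ht⟩ := exists_isMissingFace_subset hus
  have h1 := Finset.card_le_card (ht.exchangeSet_subset hts hs)
  rw [Finset.card_insert_of_notMem fun h => hu (mem_exchangeSet.mp h).1] at h1
  have := ht.card_le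
  omega

end Extremal

/-! ### Simplices where a cochain is maximal -/

section MaxAt

variable {V : Type*} {X : PreAbstractSimplicialComplex V} {k : ℤ}

/-- The cochain `φ` is maximal in absolute value at the `k`-simplex `s`. -/
def Cochain.IsMaxAt (φ : X.Cochain k) (s : Finset V) : Prop :=
  X.IsSimplex s ∧ (s.card : ℤ) = k + 1 ∧ ∀ t, |Cochain.extend φ t| ≤ |Cochain.extend φ s|

theorem Cochain.exists_isMaxAt [Finite V] [Nonempty (X.KSimplex k)] (φ : X.Cochain k) :
    ∃ s, Cochain.IsMaxAt φ s := by
  obtain ⟨s, hs⟩ := Finite.exists_max fun s => |φ s|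
  refine ⟨s.1, s.2.1, s.2.2, fun t => ?_⟩
  rw [Cochain.extend_coe]
  unfold Cochain.extend
  split_ifs with h
  · exact hs _
  · simp

theorem Cochain.IsMaxAt.extend_ne_zero {φ : X.Cochain k} (hφ : φ ≠ 0) {s : Finset V}
    (hs : Cochain.IsMaxAt φ s) : Cochain.extend φ s ≠ 0 := by
  intro h
  apply hφ
  funext t
  have := hs.2.2 t.1
  rwa [h, abs_zero, abs_nonpos_iff, Cochain.extend_coe] at this

theorem Cochain.sum_extend_exchange [DecidableEq V] (φ : X.Cochain k) (s : Finset V) (u : V) (f : V → ℝ) :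
    ∑ v ∈ s, f v * Cochain.extend φ (insert u (s.erase v)) =
      ∑ v ∈ X.exchangeSet s u, f v * Cochain.extend φ (insert u (s.erase v)) := by
  symm
  refine Finset.sum_subset (fun v hv => (mem_exchangeSet.mp hv).1) fun v hv hvn => ?_
  rw [Cochain.extend_of_not_isSimplex _ fun h => hvn (mem_exchangeSet.mpr ⟨hv, h⟩), mul_zero]

end MaxAt

/-! ### Equality in Gershgorin's bound -/

section Gershgorin

variable {V : Type*} [Fintype V] [LinearOrder V] {X : PreAbstractSimplicialComplex V} {k : ℤ}

/-- The equality case of Gershgorin's bound for the Laplacian. -/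
theorem Cochain.IsMaxAt.gershgorin_eq {ω : V → ℝ} (hω : ∀ v, 0 < ω v) {m : ℝ}
    (hm : IsLeast (Set.range fun s : X.KSimplex k => ∑ v ∈ s.1, ω v) m)
    {φ : X.Cochain k} (hφ : φ ≠ 0)
    (hL : X.laplacian ω k φ =
      (((X.maxMissingDim : ℝ) + 1) * m - X.maxMissingDim * ∑ v, ω v) • φ)
    {s : Finset V} (hs : Cochain.IsMaxAt φ s) :
    ∑ v ∈ s, ω v = m ∧ ∀ u ∉ s, ¬ X.IsSimplex (insert u s) ∧
      (X.exchangeSet s u).card = X.maxMissingDim ∧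
      ∀ v ∈ X.exchangeSet s u,
        vertexSign (s.erase v) u * Cochain.extend φ (insert u (s.erase v)) =
          -(vertexSign (s.erase v) v * Cochain.extend φ s) := by
  classical
  set d := X.maxMissingDim with hd
  set a := Cochain.extend φ s with ha
  have ha0 : 0 < a ^ 2 := by
    have := hs.extend_ne_zero hφ
    positivity
  have hm' : m ≤ ∑ v ∈ s, ω v := hm.2 ⟨⟨s, hs.1, hs.2.1⟩, rfl⟩
  let x : V → V → ℝ := fun u v => vertexSign (s.erase v) v * vertexSign (s.erase v) u *
    Cochain.extend φ (insert u (s.erase v))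
  have hx : ∀ u v, 0 ≤ a ^ 2 + a * x u v := by
    intro u v
    have h1 : |x u v| ≤ |a| := by
      simp only [x, abs_mul, abs_vertexSign, one_mul]
      exact hs.2.2 _
    have h2 : |a * x u v| ≤ a ^ 2 := by
      rw [abs_mul, ← sq_abs a, sq]
      exact mul_le_mul_of_nonneg_left h1 (abs_nonneg a)
    linarith [neg_abs_le (a * x u v)]
  -- `B u` is the excess of the contribution of `u`, multiplied by `a` and divided by `ω u`, over
  -- its worst case `-d * a ^ 2`.
  let B : V → ℝ := fun u => if X.IsSimplex (insert u s) then ((d : ℝ) + 1) * a ^ 2 else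
    ((d : ℝ) - (X.exchangeSet s u).card) * a ^ 2 + ∑ v ∈ X.exchangeSet s u, (a ^ 2 + a * x u v)
  have hcard : ∀ u ∈ sᶜ, ¬ X.IsSimplex (insert u s) →
      0 ≤ ((d : ℝ) - (X.exchangeSet s u).card) * a ^ 2 := by
    intro u hu h
    have : ((X.exchangeSet s u).card : ℝ) ≤ d :=
      Nat.cast_le.mpr (card_exchangeSet_le hs.1 (Finset.mem_compl.mp hu) h)
    exact mul_nonneg (by linarith) ha0.le
  have hB : ∀ u ∈ sᶜ, 0 ≤ ω u * B u := by
    intro u hu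
    refine mul_nonneg (hω u).le ?_
    simp only [B]
    split_ifs with h
    · positivity
    · exact add_nonneg (hcard u hu h) (Finset.sum_nonneg fun v _ => hx u v)
  -- Row `s` of the eigenvalue equation times `a`, arranged as a vanishing sum of nonnegative terms;
  -- hence each term is zero.
  have key : ((d : ℝ) + 1) * (∑ v ∈ s, ω v - m) * a ^ 2 + ∑ u ∈ sᶜ, ω u * B u = 0 := by
    have h := congrFun hL ⟨s, hs.1, hs.2.1⟩
    have hφs : φ ⟨s, hs.1, hs.2.1⟩ = a := (Cochain.extend_of_isSimplex φ hs.1 hs.2.1).symm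
    rw [laplacian_apply hω, Pi.smul_apply, smul_eq_mul, hφs] at h
    dsimp only at h
    have hB' : ∀ u ∈ sᶜ, ω u * B u = d * a ^ 2 * ω u + a * (ω u *
        (if X.IsSimplex (insert u s) then a else ∑ v ∈ s, x u v)) := by
      intro u _
      simp only [B]
      split_ifs
      · ring
      · rw [show ∑ v ∈ s, x u v = ∑ v ∈ X.exchangeSet s u, x u v from
          Cochain.sum_extend_exchange φ s u _, Finset.sum_add_distrib, ← Finset.mul_sum,
          Finset.sum_const, nsmul_eq_mul]
        ring
    rw [Finset.sum_congr rfl hB', Finset.sum_add_distrib, ← Finset.mul_sum, ← Finset.mul_sum]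
    rw [← Finset.sum_add_sum_compl s ω] at h
    linear_combination a * h
  have h0 : 0 ≤ ((d : ℝ) + 1) * (∑ v ∈ s, ω v - m) * a ^ 2 :=
    mul_nonneg (mul_nonneg (by positivity) (by linarith)) ha0.le
  have hsum := Finset.sum_nonneg hB
  have hB0 := (Finset.sum_eq_zero_iff_of_nonneg hB).mp (by linarith)
  have hm0 : ((d : ℝ) + 1) * (∑ v ∈ s, ω v - m) * a ^ 2 = 0 := by linarith
  refine ⟨?_, fun u hu => ?_⟩
  · have hd1 : (d : ℝ) + 1 ≠ 0 := by positivity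
    have := (mul_eq_zero.mp ((mul_eq_zero.mp hm0).resolve_right ha0.ne')).resolve_left hd1
    linarith
  · have hu' := Finset.mem_compl.mpr hu
    have hBu := (mul_eq_zero.mp (hB0 u hu')).resolve_left (hω u).ne'
    have hus : ¬ X.IsSimplex (insert u s) := by
      intro h
      simp only [B, if_pos h] at hBu
      have : 0 < ((d : ℝ) + 1) * a ^ 2 := by positivity
      linarith
    simp only [B, if_neg hus] at hBu
    have h1 := hcard u hu' hus
    have h2 := Finset.sum_nonneg fun v (_ : v ∈ X.exchangeSet s u) => hx u v
    refine ⟨hus, ?_, fun v hv => ?_⟩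
    · have h3 : ((d : ℝ) - (X.exchangeSet s u).card) * a ^ 2 = 0 := by linarith
      have h4 := (mul_eq_zero.mp h3).resolve_right ha0.ne'
      exact_mod_cast (sub_eq_zero.mp h4).symm
    · have h3 := (Finset.sum_eq_zero_iff_of_nonneg fun v _ => hx u v).mp (by linarith) v hv
      have h4 : a * (a + x u v) = 0 := by linarith
      have h5 := (mul_eq_zero.mp h4).resolve_left (hs.extend_ne_zero hφ)
      simp only [x] at h5
      linear_combination vertexSign (s.erase v) v * h5 - vertexSign (s.erase v) u *
        Cochain.extend φ (insert u (s.erase v)) * vertexSign_mul_self (s.erase v) v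

end Gershgorin

/-! ### Circuits -/

section Circuit

variable {V : Type*} [DecidableEq V] {X : PreAbstractSimplicialComplex V}

/-- The vertex `u` with the vertices of `s` that can be exchanged for it. -/
def circuit (X : PreAbstractSimplicialComplex V) (s : Finset V) (u : V) : Finset V :=
  insert u (X.exchangeSet s u)

theorem notMem_exchangeSet {s : Finset V} {u : V} (hu : u ∉ s) (w : V) :
    u ∉ X.exchangeSet s w :=
  fun h => hu (mem_exchangeSet.mp h).1

theorem circuit_subset (s : Finset V) (u : V) : X.circuit s u ⊆ insert u s :=
  Finset.insert_subset_insert u fun _ hv => (mem_exchangeSet.mp hv).1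

end Circuit

/-! ### Combinatorics of exchange families -/

section Exchange

variable {V : Type*} [Fintype V] [DecidableEq V] {X : PreAbstractSimplicialComplex V}

/-- A family of facets that is closed under exchanges, such that every vertex outside a member has
exactly `h(X)` exchanges and exchanges of different vertices do not interfere. -/
structure IsExchangeFamily (X : PreAbstractSimplicialComplex V) (P : Finset V → Prop) : Prop where
  isSimplex {s : Finset V} (hs : P s) : X.IsSimplex s
  not_isSimplex_insert {s : Finset V} (hs : P s) {u : V} (hu : u ∉ s) : ¬ X.IsSimplex (insert u s)
  card_exchangeSet {s : Finset V} (hs : P s) {u : V} (hu : u ∉ s) :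
    (X.exchangeSet s u).card = X.maxMissingDim
  exchange {s : Finset V} (hs : P s) {u : V} (hu : u ∉ s) {v : V} (hv : v ∈ X.exchangeSet s u) :
    P (insert u (s.erase v))
  disjoint {s : Finset V} (hs : P s) {u w : V} (hu : u ∉ s) (hw : w ∉ s) (huw : u ≠ w) :
    Disjoint (X.exchangeSet s u) (X.exchangeSet s w)

namespace IsExchangeFamily

variable {P : Finset V → Prop} (hP : X.IsExchangeFamily P) {s : Finset V}
include hP

theorem card_circuit (hs : P s) {u : V} (hu : u ∉ s) :
    (X.circuit s u).card = X.maxMissingDim + 1 := by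
  rw [circuit, Finset.card_insert_of_notMem (notMem_exchangeSet hu u), hP.card_exchangeSet hs hu]

/-- A missing face here contains the circuit and has at most `d + 1` vertices, which the circuit
already has. This uniqueness identifies circuits after an exchange. -/
theorem eq_circuit (hs : P s) {u : V} (hu : u ∉ s) {t : Finset V} (ht : X.IsMissingFace t)
    (hts : t ⊆ insert u s) : t = X.circuit s u :=
  (Finset.eq_of_subset_of_card_le (ht.exchangeSet_subset hts (hP.isSimplex hs)) (by
    rw [← circuit, hP.card_circuit hs hu]
    exact ht.card_le)).symm

theorem isMissingFace_circuit (hs : P s) {u : V} (hu : u ∉ s) :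
    X.IsMissingFace (X.circuit s u) := by
  obtain ⟨t, hts, ht⟩ := exists_isMissingFace_subset (hP.not_isSimplex_insert hs hu)
  rwa [← hP.eq_circuit hs hu ht hts]

theorem disjoint_circuit (hs : P s) {u w : V} (hu : u ∉ s) (hw : w ∉ s) (huw : u ≠ w) :
    Disjoint (X.circuit s u) (X.circuit s w) := by
  simp only [circuit, Finset.disjoint_insert_left, Finset.disjoint_insert_right,
    Finset.mem_insert, not_or]
  exact ⟨⟨huw.symm, notMem_exchangeSet hw u⟩, notMem_exchangeSet hu w, hP.disjoint hs hu hw huw⟩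

theorem circuit_exchange_self (hs : P s) {u v : V} (hu : u ∉ s) (hv : v ∈ X.exchangeSet s u) :
    X.circuit (insert u (s.erase v)) v = X.circuit s u := by
  have hvs := (mem_exchangeSet.mp hv).1
  refine (hP.eq_circuit (hP.exchange hs hu hv) ?_ (hP.isMissingFace_circuit hs hu) ?_).symm
  · simp only [Finset.mem_insert, Finset.mem_erase, ne_eq, not_true_eq_false, false_and, or_false]
    exact fun h => hu (h ▸ hvs)
  · rw [Finset.insert_comm, Finset.insert_erase hvs]
    exact circuit_subset s u

theorem circuit_exchange_of_ne (hs : P s) {u v w : V} (hu : u ∉ s) (hv : v ∈ X.exchangeSet s u)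
    (hw : w ∉ s) (hwu : w ≠ u) :
    X.circuit (insert u (s.erase v)) w = X.circuit s w := by
  refine (hP.eq_circuit (hP.exchange hs hu hv) ?_ (hP.isMissingFace_circuit hs hw) ?_).symm
  · simp [hwu, hw]
  · intro x hx
    have hxv : x ≠ v := by
      rintro rfl
      exact Finset.disjoint_left.mp (hP.disjoint_circuit hs hu hw hwu.symm)
        (Finset.mem_insert_of_mem hv) hx
    have := circuit_subset s w hx
    simp only [Finset.mem_insert, Finset.mem_erase] at this ⊢
    tauto

/-- For the converse, induct on the size of `t \ s`: exchange some `u` in it for a vertex `v` of its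
circuit outside `t`. The family of circuits stays the same, and `u` leaves the difference. -/
theorem isSimplex_iff (hs : P s) (t : Finset V) :
    X.IsSimplex t ↔ ∀ u ∉ s, ¬ X.circuit s u ⊆ t := by
  refine ⟨fun ht u hu h => (hP.isMissingFace_circuit hs hu).1 (ht.mono h), fun h => ?_⟩
  induction hn : (t \ s).card generalizing s with
  | zero =>
    rw [Finset.card_eq_zero, Finset.sdiff_eq_empty_iff_subset] at hn
    exact (hP.isSimplex hs).mono hn
  | succ n ih =>
    obtain ⟨u, hut⟩ := Finset.card_pos.mp (by omega : 0 < (t \ s).card)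
    obtain ⟨hut', hu⟩ := Finset.mem_sdiff.mp hut
    obtain ⟨v, hv, hvt⟩ := Finset.not_subset.mp (h u hu)
    have hvu : v ≠ u := fun h => hvt (h ▸ hut')
    have hv' : v ∈ X.exchangeSet s u := Finset.mem_of_mem_insert_of_ne hv hvu
    have hvs := (mem_exchangeSet.mp hv').1
    refine ih (hP.exchange hs hu hv') (fun w hw => ?_) ?_
    -- The new outside vertex `v` takes over the circuit of `u`; the other circuits are unchanged.
    · by_cases hwv : w = v
      · rw [hwv, hP.circuit_exchange_self hs hu hv']
        exact h u hu
      · simp only [Finset.mem_insert, Finset.mem_erase, not_or, not_and] at hw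
        rw [hP.circuit_exchange_of_ne hs hu hv' (hw.2 hwv) hw.1]
        exact h w (hw.2 hwv)
    · have : t \ insert u (s.erase v) = (t \ s).erase u := by
        ext x
        simp only [Finset.mem_sdiff, Finset.mem_insert, Finset.mem_erase]
        have hxv : x ∈ t → x ≠ v := fun hx h => hvt (h ▸ hx)
        tauto
      rw [this, Finset.card_erase_of_mem hut, hn, Nat.add_sub_cancel]

/-- A simplex misses a vertex of each circuit. The circuits are disjoint and indexed by the
complement of `s`, so the complement of `t` is at least as large. -/
theorem card_le_of_isSimplex (hs : P s) {t : Finset V} (ht : X.IsSimplex t) :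
    t.card ≤ s.card := by
  have h := (hP.isSimplex_iff hs t).mp ht
  choose! f hf hft using fun u hu => Finset.not_subset.mp (h u hu)
  have hle : sᶜ.card ≤ tᶜ.card := by
    refine Finset.card_le_card_of_injOn f (fun u hu => ?_) fun u hu w hw huw => ?_
    · simp only [Finset.coe_compl, Set.mem_compl_iff, Finset.mem_coe] at hu ⊢
      exact hft u hu
    · simp only [Finset.coe_compl, Set.mem_compl_iff, Finset.mem_coe] at hu hw
      by_contra hne
      exact Finset.disjoint_left.mp (hP.disjoint_circuit hs hu hw hne) (hf u hu)
        (huw ▸ hf w hw)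
  rw [Finset.card_compl, Finset.card_compl] at hle
  have := Finset.card_le_univ s
  have := Finset.card_le_univ t
  omega

end IsExchangeFamily

end Exchange

/-! ### Simplices of the model complex -/

section Model

variable {V W : Type*}

theorem isSimplex_top (s : Finset V) : (⊤ : PreAbstractSimplicialComplex V).IsSimplex s :=
  s.eq_empty_or_nonempty.imp_right fun h => h

theorem isSimplex_join (X : PreAbstractSimplicialComplex V) (Y : PreAbstractSimplicialComplex W)
    (s : Finset (V ⊕ W)) :
    (X.join Y).IsSimplex s ↔ X.IsSimplex s.toLeft ∧ Y.IsSimplex s.toRight := by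
  constructor
  · rintro (rfl | h)
    · exact ⟨Or.inl rfl, Or.inl rfl⟩
    · exact h.2
  · intro h
    exact s.eq_empty_or_nonempty.imp_right fun hs => ⟨hs, h⟩

theorem isSimplex_joinPower (X : PreAbstractSimplicialComplex V) (t : ℕ)
    (s : Finset (Fin t × V)) :
    (X.joinPower t).IsSimplex s ↔ ∀ i,
      X.IsSimplex (s.preimage (fun v => (i, v)) (Prod.mk_right_injective i).injOn) := by
  constructor
  · rintro (rfl | h)
    · exact fun i => Or.inl (by simp)
    · exact h.2
  · intro h
    exact s.eq_empty_or_nonempty.imp_right fun hs => ⟨hs, h⟩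

theorem isSimplex_simplexBoundary (d : ℕ) (s : Finset (Fin (d + 1))) :
    (simplexBoundary d).IsSimplex s ↔ ¬ ∀ a, a ∈ s := by
  rw [← Finset.eq_univ_iff_forall, ← Finset.card_eq_iff_eq_univ, Fintype.card_fin]
  have hle := Finset.card_le_univ s
  rw [Fintype.card_fin] at hle
  constructor
  · rintro (rfl | h)
    · simp
    · have := h.2
      omega
  · intro h
    refine s.eq_empty_or_nonempty.imp_right fun hs => ⟨hs, ?_⟩
    omega

theorem isSimplex_model (d t r : ℕ) (s : Finset ((Fin t × Fin (d + 1)) ⊕ Fin r)) :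
    (((simplexBoundary d).joinPower t).join (⊤ : PreAbstractSimplicialComplex (Fin r))).IsSimplex s
      ↔ ∀ i, ¬ ∀ a, Sum.inl (i, a) ∈ s := by
  simp [isSimplex_join, isSimplex_joinPower, isSimplex_simplexBoundary, isSimplex_top]

end Model

/-! ### Isomorphisms with the model -/

namespace IsExchangeFamily

variable {V : Type*} [Fintype V] [DecidableEq V] {X : PreAbstractSimplicialComplex V}
  {P : Finset V → Prop} (hP : X.IsExchangeFamily P) {s : Finset V}
include hP

theorem exists_iso (hs : P s) {d : ℕ} (hd : X.maxMissingDim = d) :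
    (d + 1) * sᶜ.card ≤ Fintype.card V ∧
    Nonempty (X.Iso (((simplexBoundary d).joinPower sᶜ.card).join
      (⊤ : PreAbstractSimplicialComplex (Fin (Fintype.card V - (d + 1) * sᶜ.card))))) := by
  subst hd
  set d := X.maxMissingDim
  let ι : Fin sᶜ.card ≃ {u // u ∈ sᶜ} := sᶜ.equivFin.symm
  have hι : ∀ i, (ι i).1 ∉ s := fun i => Finset.mem_compl.mp (ι i).2
  let κ (i : Fin sᶜ.card) : Fin (d + 1) ≃ X.circuit s (ι i) :=
    ((X.circuit s (ι i)).equivFinOfCardEq (hP.card_circuit hs (hι i))).symm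
  let f : Fin sᶜ.card × Fin (d + 1) → V := fun p => κ p.1 p.2
  have hf : Function.Injective f := by
    rintro ⟨i, a⟩ ⟨j, b⟩ h
    change (κ i a).1 = (κ j b).1 at h
    obtain rfl : i = j := by
      by_contra hij
      exact Finset.disjoint_left.mp (hP.disjoint_circuit hs (hι i) (hι j)
        fun h => hij (ι.injective (Subtype.ext h))) (κ i a).2 (h ▸ (κ j b).2)
    rw [(κ i).injective (Subtype.ext h)]
  have hcard : Fintype.card (Fin sᶜ.card × Fin (d + 1)) = (d + 1) * sᶜ.card := by
    rw [Fintype.card_prod, Fintype.card_fin, Fintype.card_fin, mul_comm]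
  have hle := Fintype.card_le_of_injective f hf
  rw [hcard] at hle
  refine ⟨hle, ?_⟩
  classical
  have hrest : Fintype.card ((Set.range f)ᶜ : Set V) = Fintype.card V - (d + 1) * sᶜ.card := by
    rw [Fintype.card_compl_set, Set.card_range_of_injective hf, hcard]
  -- Copies of the simplex boundary go to circuits, and the cone points to the vertices in no
  -- circuit.
  let e : (Fin sᶜ.card × Fin (d + 1)) ⊕ Fin (Fintype.card V - (d + 1) * sᶜ.card) ≃ V :=
    ((Equiv.ofInjective f hf).sumCongr (Fintype.equivFinOfCardEq hrest).symm).trans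
      (Equiv.Set.sumCompl (Set.range f))
  have he : ∀ i a, e (Sum.inl (i, a)) = κ i a := fun i a => rfl
  refine ⟨⟨e.symm, fun t => ?_⟩⟩
  rw [isSimplex_model, hP.isSimplex_iff hs]
  have hmem : ∀ x, x ∈ t.map e.symm.toEmbedding ↔ e x ∈ t := fun x => by
    simp [Finset.mem_map_equiv]
  simp_rw [hmem, he]
  have hsub : ∀ i, (∀ a, (κ i a).1 ∈ t) ↔ X.circuit s (ι i) ⊆ t := fun i => by
    rw [(κ i).forall_congr_left]
    simp [Finset.subset_iff]
  simp_rw [hsub]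
  exact ⟨fun h u hu => by simpa using h (ι.symm ⟨u, Finset.mem_compl.mpr hu⟩),
    fun h i => h _ (hι i)⟩

/-- Under any isomorphism a copy corresponds to a non-simplex with `d + 1` vertices. It contains a
circuit, which has the same size and so is all of it. -/
theorem exists_circuit_of_iso (hs : P s) {d : ℕ} (hd : X.maxMissingDim = d) {t r : ℕ}
    (e : X.Iso (((simplexBoundary d).joinPower t).join
      (⊤ : PreAbstractSimplicialComplex (Fin r)))) (i : Fin t) :
    ∃ u ∉ s, ∀ a, e.symm (Sum.inl (i, a)) ∈ X.circuit s u := by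
  let g : Fin (d + 1) ↪ V := ⟨fun a => e.symm (Sum.inl (i, a)), fun a b h => by simpa using h⟩
  have hns : ¬ X.IsSimplex (Finset.univ.map g) := by
    rw [← e.isSimplex_map_iff, isSimplex_model]
    push Not
    refine ⟨i, fun a => ?_⟩
    rw [Finset.mem_map_equiv]
    exact Finset.mem_map_of_mem g (Finset.mem_univ a)
  rw [hP.isSimplex_iff hs] at hns
  push Not at hns
  obtain ⟨u, hu, hsub⟩ := hns
  refine ⟨u, hu, fun a => ?_⟩
  rw [Finset.eq_of_subset_of_card_le hsub (by
    rw [hP.card_circuit hs hu, hd, Finset.card_map, Finset.card_univ, Fintype.card_fin])]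
  exact Finset.mem_map_of_mem g (Finset.mem_univ a)

end IsExchangeFamily

/-! ### Exchanges preserve maximality -/

section MaxAtExchange

variable {V : Type*} [LinearOrder V] {X : PreAbstractSimplicialComplex V} {k : ℤ}
  {φ : X.Cochain k}

theorem Cochain.IsMaxAt.exchange {s : Finset V} (hs : Cochain.IsMaxAt φ s) {u v : V}
    (hu : u ∉ s) (hv : v ∈ X.exchangeSet s u)
    (h : vertexSign (s.erase v) u * Cochain.extend φ (insert u (s.erase v)) =
      -(vertexSign (s.erase v) v * Cochain.extend φ s)) :
    Cochain.IsMaxAt φ (insert u (s.erase v)) := by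
  obtain ⟨hvs, hX⟩ := mem_exchangeSet.mp hv
  refine ⟨hX, ?_, fun t => ?_⟩
  · rw [Finset.card_insert_of_notMem fun h => hu (Finset.mem_of_mem_erase h),
      Finset.card_erase_add_one hvs]
    exact hs.2.1
  · have := congrArg abs h
    rw [abs_neg, abs_mul, abs_mul, abs_vertexSign, abs_vertexSign, one_mul, one_mul] at this
    rw [this]
    exact hs.2.2 t

end MaxAtExchange

/-! ### Consequences of equality -/

section EqualityCase

variable {V : Type*} [Fintype V] [LinearOrder V] {X : PreAbstractSimplicialComplex V} {k : ℤ}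
  {ω : V → ℝ} {m : ℝ} {φ : X.Cochain k}

theorem isExchangeFamily_isMaxAt (hω : ∀ v, 0 < ω v)
    (hm : IsLeast (Set.range fun s : X.KSimplex k => ∑ v ∈ s.1, ω v) m) (hφ : φ ≠ 0)
    (hL : X.laplacian ω k φ =
      (((X.maxMissingDim : ℝ) + 1) * m - X.maxMissingDim * ∑ v, ω v) • φ) :
    X.IsExchangeFamily (Cochain.IsMaxAt φ) where
  isSimplex hs := hs.1
  not_isSimplex_insert hs _ hu := ((hs.gershgorin_eq hω hm hφ hL).2 _ hu).1
  card_exchangeSet hs _ hu := ((hs.gershgorin_eq hω hm hφ hL).2 _ hu).2.1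
  exchange hs _ hu _ hv :=
    hs.exchange hu hv (((hs.gershgorin_eq hω hm hφ hL).2 _ hu).2.2 _ hv)
  disjoint {s} hs u w hu hw huw := by
    rw [Finset.disjoint_left]
    intro v hvu hvw
    have h1 := ((hs.gershgorin_eq hω hm hφ hL).2 u hu).2.2 v hvu
    have h2 := ((hs.gershgorin_eq hω hm hφ hL).2 w hw).2.2 v hvw
    have hs' := hs.exchange hu hvu h1
    have hu' : u ∉ s.erase v := fun h => hu (Finset.mem_of_mem_erase h)
    have hw' : w ∉ insert u (s.erase v) := by simp [huw.symm, hw]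
    have h3 := ((hs'.gershgorin_eq hω hm hφ hL).2 w hw').2.2 u (mem_exchangeSet.mpr
      ⟨Finset.mem_insert_self _ _, by
        rw [Finset.erase_insert hu']
        exact (mem_exchangeSet.mp hvw).2⟩)
    rw [Finset.erase_insert hu'] at h3
    -- The signed values at `s - v + u`, `s - v + w` and `s` are pairwise negatives of each other,
    -- so all three vanish.
    have h4 : vertexSign (s.erase v) v * Cochain.extend φ s = 0 := by linarith
    refine hs.extend_ne_zero hφ ((mul_eq_zero.mp h4).resolve_left fun h => ?_)
    have := vertexSign_mul_self (s.erase v) v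
    simp [h] at this

/-- Both `s` and `s - v + u` are maximal, so both have total weight `m`. -/
theorem Cochain.IsMaxAt.weight_eq_of_mem_circuit (hω : ∀ v, 0 < ω v)
    (hm : IsLeast (Set.range fun s : X.KSimplex k => ∑ v ∈ s.1, ω v) m) (hφ : φ ≠ 0)
    (hL : X.laplacian ω k φ =
      (((X.maxMissingDim : ℝ) + 1) * m - X.maxMissingDim * ∑ v, ω v) • φ)
    {s : Finset V} (hs : Cochain.IsMaxAt φ s) {u v : V} (hu : u ∉ s) (hv : v ∈ X.circuit s u) :
    ω v = ω u := by
  rcases Finset.mem_insert.mp hv with rfl | hv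
  · rfl
  · have h1 := (hs.gershgorin_eq hω hm hφ hL).1
    have hs' := (isExchangeFamily_isMaxAt hω hm hφ hL).exchange hs hu hv
    have h2 := (hs'.gershgorin_eq hω hm hφ hL).1
    rw [Finset.sum_insert fun h => hu (Finset.mem_of_mem_erase h)] at h2
    rw [← Finset.add_sum_erase s ω (mem_exchangeSet.mp hv).1] at h1
    linarith

end EqualityCase

end PreAbstractSimplicialComplex

end

/-! ### The main theorem -/

theorem theorem4p9 {V : Type*} [Fintype V] [LinearOrder V]
    (X : PreAbstractSimplicialComplex V) (ω : V → ℝ) (hω : ∀ v, 0 < ω v)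
    (d : ℕ) (hd : X.maxMissingDim = d) (k : ℤ) (m : ℝ)
    (hm : IsLeast (Set.range fun s : X.KSimplex k => ∑ v ∈ s.1, ω v) m)
    (hgap : IsLeast {μ : ℝ | (X.laplacian ω k).HasEigenvalue μ}
      (((d : ℝ) + 1) * m - (d : ℝ) * ∑ v, ω v)) :
    X.dim = k ∧
    ∃ t r : ℕ, (t : ℤ) = (Fintype.card V : ℤ) - k - 1 ∧
      (r : ℤ) = ((d : ℤ) + 1) * (k + 1) - (d : ℤ) * (Fintype.card V : ℤ) ∧
      Nonempty (X.Iso (((PreAbstractSimplicialComplex.simplexBoundary d).joinPower t).join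
        (⊤ : PreAbstractSimplicialComplex (Fin r)))) ∧
      ∀ e : X.Iso (((PreAbstractSimplicialComplex.simplexBoundary d).joinPower t).join
          (⊤ : PreAbstractSimplicialComplex (Fin r))),
        ∀ (i : Fin t) (a b : Fin (d + 1)),
          ω (e.symm (Sum.inl (i, a))) = ω (e.symm (Sum.inl (i, b))) := by
  classical
  obtain ⟨φ, hφ⟩ := Module.End.HasEigenvalue.exists_hasEigenvector hgap.1
  have hL := hφ.apply_eq_smul
  rw [← hd] at hL
  obtain ⟨s₀, -⟩ := hm.1
  have : Nonempty (X.KSimplex k) := ⟨s₀⟩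
  obtain ⟨s, hs⟩ := PreAbstractSimplicialComplex.Cochain.exists_isMaxAt φ
  have hP := PreAbstractSimplicialComplex.isExchangeFamily_isMaxAt hω hm hφ.2 hL
  obtain ⟨hle, hiso⟩ := hP.exists_iso hs hd
  have hcard : (s.card : ℤ) = k + 1 := hs.2.1
  have hcompl : (sᶜ.card : ℤ) = (Fintype.card V : ℤ) - k - 1 := by
    have := Finset.card_add_card_compl s
    omega
  refine ⟨?_, sᶜ.card, Fintype.card V - (d + 1) * sᶜ.card, hcompl, ?_, hiso, fun e i a b => ?_⟩
  · rw [PreAbstractSimplicialComplex.dim, sub_eq_iff_eq_add, ← hcard, Nat.cast_inj]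
    apply le_antisymm
    · exact Finset.sup_le fun t ht => hP.card_le_of_isSimplex hs (Finset.mem_filter.mp ht).2
    · exact Finset.le_sup (f := Finset.card) (Finset.mem_filter.mpr ⟨Finset.mem_univ s, hs.1⟩)
  -- The disjoint circuits fit into `V`, so the subtraction does not truncate.
  · rw [Nat.cast_sub hle]
    push_cast
    rw [hcompl]
    ring
  · obtain ⟨u, hu, h⟩ := hP.exists_circuit_of_iso hs hd e i
    rw [hs.weight_eq_of_mem_circuit hω hm hφ.2 hL hu (h a),
      hs.weight_eq_of_mem_circuit hω hm hφ.2 hL hu (h b)]
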